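/- Let $0\le m<n$ and $q=n-m$. Let $X$ be a complex manifold of dimension $n$, let $E$ be a holomorphic line bundle over $X$, and let $f:\mathbb{C}^m\to X$ be a holomorphic mapping. Let $\varphi$ be a holomorphic field of $f$ over $\mathbb{C}^m$ of degree $q$ with respect to $E$, i.e. a holomorphic section of $f^*\big(E\otimes\bigwedge^q T_X\big)$ over $\mathbb{C}^m$. Let $F_\varphi$ be the Jacobian section of $f$ defined by $\varphi$, i.e. the section of $f^*E\otimes K_{\mathbb{C}^m}\otimes f^*K_X^*$ that corresponds to the map $\Psi\mapsto f^*(\Psi\angle\varphi)$ from $f^*K_X$ to $f^*E\otimes K_{\mathbb{C}^m}$. Here the interior product $\Psi\angle\xi\in E\otimes\bigwedge^m T_X^*$ of $\Psi\in K_X$ and $\xi\in E\otimes\bigwedge^q T_X$ is given by $(\Psi\angle\xi)(\theta)=\Psi(\xi\wedge\theta)$ for $\theta\in\bigwedge^m T_X$. The field $\varphi$ is called effective if the zero set of $F_\varphi$ is thin, i.e. has dense complement in $\mathbb{C}^m$. For $j=1,\dots,m$ let $\mathfrak{Z}_j=f_*(\partial/\partial z_j)$, a section of $f^*T_X$, and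 set $$\mathscr{Z}=\mathfrak{Z}_1\wedge\cdots\wedge\mathfrak{Z}_m\wedge\varphi,$$ a section of $f^*\big(E\otimes\bigwedge^n T_X\big)=f^*(E\otimes K_X^*)$. Then $F_\varphi$ and $\mathscr{Z}$ are holomorphic sections, and $\varphi$ is effective if and only if $\mathscr{Z}\not\equiv 0$. Moreover, the ramification divisor $(F_\varphi)$ equals the zero divisor $(\mathscr{Z})$: at every point of $\mathbb{C}^m$ the sections $F_\varphi$ and $\mathscr{Z}$ have the same multiplicity of zero, i.e. their coefficient functions in local holomorphic frames have the same order of vanishing (with the convention that the section $\equiv 0$ has multiplicity $\infty$ everywhere). -/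

import Mathlib

open scoped Manifold ContDiff TensorProduct

namespace JacobianSection

noncomputable section

/-- The complex coordinate space of dimension `k`. -/
abbrev CSpace (k : ℕ) : Type := EuclideanSpace ℂ (Fin k)

section LinearAlgebra

variable {V W : Type*} [AddCommGroup V] [Module ℂ V] [AddCommGroup W] [Module ℂ W]

/-- The wedge product `Λ^a W × Λ^b W → Λ^c W`, where `a + b = c`. -/
def wedge (W : Type*) [AddCommGroup W] [Module ℂ W] {a b c : ℕ} (h : a + b = c) :
    (⋀[ℂ]^a W) →ₗ[ℂ] (⋀[ℂ]^b W) →ₗ[ℂ] (⋀[ℂ]^c W) :=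
  LinearMap.mk₂ ℂ
    (fun ξ θ => ⟨(ξ : ExteriorAlgebra ℂ W) * (θ : ExteriorAlgebra ℂ W),
      h ▸ SetLike.mul_mem_graded ξ.2 θ.2⟩)
    (fun _ _ _ => Subtype.ext (add_mul _ _ _))
    (fun _ _ _ => Subtype.ext (smul_mul_assoc _ _ _))
    (fun _ _ _ => Subtype.ext (mul_add _ _ _))
    (fun _ _ _ => Subtype.ext (mul_smul_comm _ _ _))

/-- The space of `k`-forms `Λ^k W^*`, as the linear forms on `Λ^k W` (equivalently, the alternating
`k`-linear forms on `W`). -/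
abbrev Forms (k : ℕ) (W : Type*) [AddCommGroup W] [Module ℂ W] : Type _ :=
  Module.Dual ℂ (⋀[ℂ]^k W)

/-- The pull-back `D^* : Λ^k W^* → Λ^k V^*` of `k`-forms by a linear map `D : V → W`. -/
def pullbackForm (k : ℕ) (D : V →ₗ[ℂ] W) : Forms k W →ₗ[ℂ] Forms k V :=
  (exteriorPower.map k D).dualMap

/-- The interior product `α ∠ ξ ∈ Λ^m W^*` of `α ∈ Λ^n W^*` and `ξ ∈ Λ^q W`, where `m + q = n`:
`(α ∠ ξ)(θ) = α (ξ ∧ θ)` for all `θ ∈ Λ^m W`. It is given here as a map linear in `ξ` and in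
`α`. -/
def interiorProduct (W : Type*) [AddCommGroup W] [Module ℂ W] {m q n : ℕ} (h : m + q = n) :
    (⋀[ℂ]^q W) →ₗ[ℂ] Forms n W →ₗ[ℂ] Forms m W :=
  LinearMap.mk₂ ℂ (fun ξ α => α ∘ₗ wedge W ((Nat.add_comm q m).trans h) ξ)
    (fun _ _ _ => by simp [LinearMap.comp_add])
    (fun _ _ _ => by simp [LinearMap.comp_smul])
    (fun _ _ _ => LinearMap.add_comp _ _ _)
    (fun _ _ _ => LinearMap.smul_comp _ _ _)

/-- For `D : V → W` linear (with `dim V = m`, `dim W = n = m + q`) and `ξ ∈ Λ^q W`, the element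
of `Λ^m V^* ⊗ (Λ^n W^*)^*` that corresponds to the linear map
`Λ^n W^* → Λ^m V^*, Ψ ↦ D^* (Ψ ∠ ξ)`. If `Λ^n W^*` is spanned by `Ψ`, with dual vector `Ψ^*`, then
this element is `D^* (Ψ ∠ ξ) ⊗ Ψ^*`. -/
def jacobianMap [Module.Finite ℂ W] {m q n : ℕ} (h : m + q = n) (D : V →ₗ[ℂ] W) :
    (⋀[ℂ]^q W) →ₗ[ℂ] Forms m V ⊗[ℂ] Module.Dual ℂ (Forms n W) :=
  (TensorProduct.comm ℂ (Module.Dual ℂ (Forms n W)) (Forms m V)).toLinearMap ∘ₗ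
    (dualTensorHomEquiv ℂ (Forms n W) (Forms m V)).symm.toLinearMap ∘ₗ
      (LinearMap.compRight ℂ (pullbackForm m D)) ∘ₗ interiorProduct W h

end LinearAlgebra

section Sections

variable {m : ℕ} {L : CSpace m → Type*} [∀ z, AddCommGroup (L z)] [∀ z, Module ℂ (L z)]
  {V : Type*} [AddCommGroup V] [Module ℂ V]

/-- Holomorphic sections over `ℂ^m` of a bundle with fibres `L z` and finite-dimensional model
fibre `V`. Here the maps `c z₀ z : L z → V` are, for `z` near `z₀`, the isomorphisms of a holomorphic
trivialization around `z₀`; the coordinates of the section in it have to be analytic at `z₀`. -/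
def IsHolomorphicSection (c : ∀ _z₀ z : CSpace m, L z →ₗ[ℂ] V) (s : ∀ z, L z) : Prop :=
  ∀ (z₀ : CSpace m) (ℓ : Module.Dual ℂ V), AnalyticAt ℂ (fun z => ℓ (c z₀ z (s z))) z₀

/-- The order of vanishing at `z₀` of a holomorphic function of `m` variables: the least `k` such
that the Taylor expansion at `z₀` has a nonzero term of degree `k` (`⊤` if there is none). -/
def vanishingOrder (g : CSpace m → ℂ) (z₀ : CSpace m) : ℕ∞ :=
  ⨅ (k : ℕ) (_ : iteratedFDeriv ℂ k g z₀ ≠ 0), (k : ℕ∞)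

/-- The zero divisor of a holomorphic section of a line bundle, given by its multiplicity function:
at `z₀` it is the order of vanishing of the coordinate of the section in a holomorphic
trivialization around `z₀`. (For a line bundle the model fibre `V` is one-dimensional, and all
nonzero `ℓ` give the same order.) The section that vanishes identically has multiplicity `⊤`
everywhere. -/
def zeroDivisor (c : ∀ _z₀ z : CSpace m, L z →ₗ[ℂ] V) (s : ∀ z, L z) : CSpace m → ℕ∞ :=
  fun z₀ => ⨅ ℓ : Module.Dual ℂ V, vanishingOrder (fun z => ℓ (c z₀ z (s z))) z₀

/-- A set is thin if its complement is dense. -/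
def IsThin (S : Set (CSpace m)) : Prop := Dense Sᶜ

/-- A section is effective if its zero set is thin. -/
def IsEffectiveSection (s : ∀ z, L z) : Prop := IsThin {z | s z = 0}

end Sections

section Fields

variable {m n : ℕ} {X : Type*} [TopologicalSpace X] [ChartedSpace (CSpace n) X]

instance (x : X) : Module.Finite ℂ (TangentSpace 𝓘(ℂ, CSpace n) x) :=
  inferInstanceAs (Module.Finite ℂ (CSpace n))

/-- The fibre at `x` of `E ⊗ Λ^k T_X`. The fibre at `z` of its pull-back by `f` is the fibre
at `f z`. -/
abbrev FieldFibre (E : X → Type*) [∀ x, AddCommGroup (E x)] [∀ x, Module ℂ (E x)]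
    (k : ℕ) (x : X) : Type _ :=
  E x ⊗[ℂ] (⋀[ℂ]^k (TangentSpace 𝓘(ℂ, CSpace n) x))

/-- The canonical space `K_{X,x} = Λ^n T_x^* X` at `x`, where `n = dim X`. -/
abbrev Canonical (n : ℕ) {X : Type*} [TopologicalSpace X] [ChartedSpace (CSpace n) X] (x : X) :
    Type :=
  Forms n (TangentSpace 𝓘(ℂ, CSpace n) x)

/-- The fibre at `z` of `f^*E ⊗ K(f)`, where `K(f) = K_M ⊗ f^*(K_X^*)` is the Jacobian bundle
of `f` and `M = ℂ^m`. -/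
abbrev JacobianFibre (E : X → Type*) [∀ x, AddCommGroup (E x)] [∀ x, Module ℂ (E x)]
    (f : CSpace m → X) (z : CSpace m) : Type _ :=
  E (f z) ⊗[ℂ] (Canonical m z ⊗[ℂ] Module.Dual ℂ (Canonical n (f z)))

section Trivializations

variable [IsManifold 𝓘(ℂ, CSpace n) ω X]
  (E : X → Type*) [∀ x, AddCommGroup (E x)] [∀ x, Module ℂ (E x)]
  [∀ x, TopologicalSpace (E x)] [TopologicalSpace (Bundle.TotalSpace ℂ E)]
  [FiberBundle ℂ E] [VectorBundle ℂ ℂ E]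
  (f : CSpace m → X)

/-- The coordinate map on tangent vectors at `x` in the preferred chart at `x₀`. -/
def tangentCoord (x₀ x : X) : TangentSpace 𝓘(ℂ, CSpace n) x →ₗ[ℂ] CSpace n :=
  (trivializationAt (CSpace n) (fun y : X => TangentSpace 𝓘(ℂ, CSpace n) y) x₀).linearMapAt ℂ x

/-- The coordinate map on the fibre of the line bundle `E` at `x`, in the preferred trivialization
at `x₀`. -/
def lineCoord (x₀ x : X) : E x →ₗ[ℂ] ℂ :=
  (trivializationAt ℂ E x₀).linearMapAt ℂ x

/-- The trivialization of `f^*(E ⊗ Λ^k T_X)` around `z₀` induced by the trivializations of `E` and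
of `T_X` around `f z₀`. -/
def fieldCoord (k : ℕ) (z₀ z : CSpace m) :
    FieldFibre (n := n) E k (f z) →ₗ[ℂ] ℂ ⊗[ℂ] (⋀[ℂ]^k (CSpace n)) :=
  TensorProduct.map (lineCoord E (f z₀) (f z))
    (exteriorPower.map k (tangentCoord (n := n) (f z₀) (f z)))

/-- The trivialization of `f^*E ⊗ K_M ⊗ f^*(K_X^*)`, `M = ℂ^m`, around `z₀` induced by the
trivializations of `E` and of `T_X` around `f z₀` and the global trivialization of the tangent
bundle of `ℂ^m`. -/
def jacobianCoord (z₀ z : CSpace m) :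
    JacobianFibre (n := n) E f z →ₗ[ℂ]
      ℂ ⊗[ℂ] (Forms m (CSpace m) ⊗[ℂ] Module.Dual ℂ (Forms n (CSpace n))) :=
  TensorProduct.map (lineCoord E (f z₀) (f z))
    (TensorProduct.map (LinearMap.id : Forms m (CSpace m) →ₗ[ℂ] Forms m (CSpace m))
      (pullbackForm n (tangentCoord (n := n) (f z₀) (f z))).dualMap)

/-- `φ` is a holomorphic field of `f` over `ℂ^m` of degree `q` with respect to `E`, i.e. a
holomorphic section of `f^*(E ⊗ Λ^q T_X)`. -/
def IsHolomorphicField (q : ℕ) (φ : ∀ z, FieldFibre (n := n) E q (f z)) : Prop :=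
  IsHolomorphicSection (fieldCoord E f q) φ

end Trivializations

variable {E : X → Type*} [∀ x, AddCommGroup (E x)] [∀ x, Module ℂ (E x)]

/-- The differential of `f` at `z`. -/
def differential (f : CSpace m → X) (z : CSpace m) :
    TangentSpace 𝓘(ℂ, CSpace m) z →ₗ[ℂ] TangentSpace 𝓘(ℂ, CSpace n) (f z) :=
  (mfderiv 𝓘(ℂ, CSpace m) 𝓘(ℂ, CSpace n) f z).toLinearMap

/-- The Jacobian section `F_φ` of `f` with respect to `E` defined by `φ`: locally
`F_φ = f^*(Ψ ∠ φ) ⊗ Ψ^*` for a nowhere vanishing local section `Ψ` of `K_X`, i.e. it corresponds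
to `Ψ ↦ f^*(Ψ ∠ φ)`. -/
def jacobianSection {q : ℕ} (h : m + q = n) (f : CSpace m → X)
    (φ : ∀ z, FieldFibre (n := n) E q (f z)) (z : CSpace m) : JacobianFibre (n := n) E f z :=
  LinearMap.lTensor (E (f z)) (jacobianMap h (differential f z)) (φ z)

/-- The field `φ` is effective if the Jacobian section `F_φ` is effective. -/
def IsEffectiveField {q : ℕ} (h : m + q = n) (f : CSpace m → X)
    (φ : ∀ z, FieldFibre (n := n) E q (f z)) : Prop :=
  IsEffectiveSection (jacobianSection h f φ)

/-- The section `Z_j = f_* (∂/∂z_j)` of `f^* T_X`. -/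
def pushforwardCoordField (f : CSpace m → X) (j : Fin m) (z : CSpace m) :
    TangentSpace 𝓘(ℂ, CSpace n) (f z) :=
  differential f z (EuclideanSpace.single j (1 : ℂ) : CSpace m)

/-- The section `Z_1 ∧ ⋯ ∧ Z_m ∧ φ` of `f^*(E ⊗ Λ^n T_X)`; the factor `E` is carried along. -/
def wedgeSection {q : ℕ} (h : m + q = n) (f : CSpace m → X)
    (φ : ∀ z, FieldFibre (n := n) E q (f z)) (z : CSpace m) : FieldFibre (n := n) E n (f z) :=
  LinearMap.lTensor (E (f z))
    (wedge (TangentSpace 𝓘(ℂ, CSpace n) (f z)) h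
      (exteriorPower.ιMulti ℂ m fun j => pushforwardCoordField (n := n) f j z)) (φ z)

end Fields

end

end JacobianSection

/-! A form of top degree on `ℂ^m` is determined by its value on `e_1 ∧ ⋯ ∧ e_m`, and `D^*(Ψ ∠ ξ)`
takes there the value `Ψ(ξ ∧ De_1 ∧ ⋯ ∧ De_m) = (-1)^{qm} Ψ(De_1 ∧ ⋯ ∧ De_m ∧ ξ)`. Hence `F_φ` is
the image of the wedge section under the isomorphism `w ↦ (-1)^{qm} dz_1 ∧ ⋯ ∧ dz_m ⊗ w`
(`jacobianMap_eq`). This isomorphism is natural in `W`, so in local trivializations the two sections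
differ by a constant linear isomorphism (`jacobianCoord_jacobianSection`): they share holomorphy,
zero set and orders of vanishing. Effectiveness then reduces to the identity theorem on the
connected space `ℂ^m` (`IsHolomorphicSection.isEffectiveSection`). -/

namespace JacobianSection

noncomputable section

/-! ### Exterior algebra: the pointwise comparison isomorphism. -/

section LinearAlgebra

variable {V W U : Type*} [AddCommGroup V] [Module ℂ V] [AddCommGroup W] [Module ℂ W]
  [AddCommGroup U] [Module ℂ U]

theorem mul_ι_comm {q : ℕ} {ξ : ExteriorAlgebra ℂ W} (hξ : ξ ∈ ⋀[ℂ]^q W) (w : W) :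
    ξ * ExteriorAlgebra.ι ℂ w = (-1 : ℂ) ^ q • (ExteriorAlgebra.ι ℂ w * ξ) := by
  induction hξ using Submodule.pow_induction_on_left' with
  | algebraMap r => simp [Algebra.commutes]
  | add x y i hx hy ihx ihy => rw [add_mul, ihx, ihy, mul_add, smul_add]
  | mem_mul a ha i x hx ih =>
    obtain ⟨v, rfl⟩ := ha
    have h := eq_neg_of_add_eq_zero_left (ExteriorAlgebra.ι_add_mul_swap (R := ℂ) v w)
    rw [mul_assoc, ih, mul_smul_comm, ← mul_assoc, h, neg_mul, ← mul_assoc, pow_succ]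
    simp

theorem mul_ιMulti_comm {q m : ℕ} {ξ : ExteriorAlgebra ℂ W} (hξ : ξ ∈ ⋀[ℂ]^q W)
    (v : Fin m → W) :
    ξ * ExteriorAlgebra.ιMulti ℂ m v
      = ((-1 : ℂ) ^ q) ^ m • (ExteriorAlgebra.ιMulti ℂ m v * ξ) := by
  induction m with
  | zero => simp
  | succ m ih =>
    rw [ExteriorAlgebra.ιMulti_succ_apply, ← mul_assoc, mul_ι_comm hξ, smul_mul_assoc, mul_assoc,
      ih, mul_smul_comm, smul_smul, mul_assoc, pow_succ']

@[simp] theorem coe_wedge {a b c : ℕ} (h : a + b = c) (ξ : ⋀[ℂ]^a W) (θ : ⋀[ℂ]^b W) :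
    (wedge W h ξ θ : ExteriorAlgebra ℂ W) = ξ * θ := rfl

theorem coe_exteriorPower_map {k : ℕ} (T : V →ₗ[ℂ] W) (x : ⋀[ℂ]^k V) :
    (exteriorPower.map k T x : ExteriorAlgebra ℂ W) = ExteriorAlgebra.map T x := by
  have : (Submodule.subtype _) ∘ₗ exteriorPower.map k T
      = (ExteriorAlgebra.map T).toLinearMap ∘ₗ (⋀[ℂ]^k V).subtype := by
    ext v
    simp [ExteriorAlgebra.map_apply_ιMulti]
  exact LinearMap.congr_fun this x

theorem map_wedge {a b c : ℕ} (h : a + b = c) (T : V →ₗ[ℂ] W) (ξ : ⋀[ℂ]^a V) (θ : ⋀[ℂ]^b V) :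
    exteriorPower.map c T (wedge V h ξ θ)
      = wedge W h (exteriorPower.map a T ξ) (exteriorPower.map b T θ) :=
  Subtype.ext (by simp [coe_exteriorPower_map])

/-- The volume form `dz_1 ∧ ⋯ ∧ dz_m`. -/
def volumeForm (m : ℕ) : Forms m (CSpace m) :=
  exteriorPower.alternatingMapLinearEquiv (EuclideanSpace.basisFun (Fin m) ℂ).toBasis.det

theorem volumeForm_ιMulti_basis (m : ℕ) :
    volumeForm m (exteriorPower.ιMulti ℂ m fun j => EuclideanSpace.single j (1 : ℂ)) = 1 := by
  rw [volumeForm, exteriorPower.alternatingMapLinearEquiv_apply_ιMulti]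
  convert Module.Basis.det_self (EuclideanSpace.basisFun (Fin m) ℂ).toBasis using 2
  ext1 j
  simp

theorem form_eq_smul_volumeForm {m : ℕ} (α : Forms m (CSpace m)) :
    α = α (exteriorPower.ιMulti ℂ m fun j => EuclideanSpace.single j (1 : ℂ)) • volumeForm m := by
  have h := (α.compAlternatingMap (exteriorPower.ιMulti ℂ m)).eq_smul_basis_det
    (EuclideanSpace.basisFun (Fin m) ℂ).toBasis
  refine exteriorPower.linearMap_ext (h.trans ?_)
  have hb : ⇑(EuclideanSpace.basisFun (Fin m) ℂ) = fun j => EuclideanSpace.single j (1 : ℂ) :=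
    funext fun j => by simp
  ext v
  simp [volumeForm, hb]

/-- Top forms on `ℂ^m` are identified with scalars by means of the volume form. -/
def volumeEquiv (m : ℕ) : ℂ ≃ₗ[ℂ] Forms m (CSpace m) where
  toLinearMap := LinearMap.toSpanSingleton ℂ _ (volumeForm m)
  invFun α := α (exteriorPower.ιMulti ℂ m fun j => EuclideanSpace.single j (1 : ℂ))
  left_inv c := by simp [volumeForm_ιMulti_basis]
  right_inv α := (form_eq_smul_volumeForm α).symm

theorem volumeEquiv_apply (m : ℕ) (c : ℂ) : volumeEquiv m c = c • volumeForm m := rfl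

/-- The isomorphism `w ↦ ± dz_1 ∧ ⋯ ∧ dz_m ⊗ w` from `Λ^n W` onto
`Λ^m (ℂ^m)^* ⊗ (Λ^n W^*)^*`. -/
def jacobianEquiv (W : Type*) [AddCommGroup W] [Module ℂ W] [Module.Finite ℂ W] (m q n : ℕ) :
    (⋀[ℂ]^n W) ≃ₗ[ℂ] Forms m (CSpace m) ⊗[ℂ] Module.Dual ℂ (Forms n W) :=
  LinearEquiv.smulOfNeZero ℂ _ (((-1 : ℂ) ^ q) ^ m) (by simp) ≪≫ₗ
    Module.evalEquiv ℂ (⋀[ℂ]^n W) ≪≫ₗ (TensorProduct.lid ℂ _).symm ≪≫ₗ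
      TensorProduct.congr (volumeEquiv m) (LinearEquiv.refl ℂ _)

theorem jacobianEquiv_apply [Module.Finite ℂ W] (m q n : ℕ) (w : ⋀[ℂ]^n W) :
    jacobianEquiv W m q n w
      = volumeForm m ⊗ₜ[ℂ] Module.Dual.eval ℂ (⋀[ℂ]^n W) (((-1 : ℂ) ^ q) ^ m • w) := by
  simp [jacobianEquiv, volumeEquiv_apply]

/-- Since `T` need not be invertible, this applies to the coordinate maps at every point, including
points off the base set, where they are zero. -/
theorem jacobianEquiv_naturality [Module.Finite ℂ V] [Module.Finite ℂ W] (m q n : ℕ)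
    (T : V →ₗ[ℂ] W) (w : ⋀[ℂ]^n V) :
    TensorProduct.map LinearMap.id (pullbackForm n T).dualMap (jacobianEquiv V m q n w)
      = jacobianEquiv W m q n (exteriorPower.map n T w) := by
  rw [jacobianEquiv_apply, jacobianEquiv_apply, TensorProduct.map_tmul, ← map_smul]
  rfl

theorem jacobianMap_eq [Module.Finite ℂ W] {m q n : ℕ} (h : m + q = n)
    (D : CSpace m →ₗ[ℂ] W) (ξ : ⋀[ℂ]^q W) :
    jacobianMap h D ξ = jacobianEquiv W m q n (wedge W h
      (exteriorPower.ιMulti ℂ m fun j => D (EuclideanSpace.single j (1 : ℂ))) ξ) := by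
  rw [jacobianEquiv_apply]
  change TensorProduct.comm ℂ _ _ ((dualTensorHomEquiv ℂ (Forms n W) (Forms m (CSpace m))).symm
    ((pullbackForm m D) ∘ₗ interiorProduct W h ξ)) = _
  rw [← LinearEquiv.eq_symm_apply, LinearEquiv.symm_apply_eq]
  ext1 Ψ
  rw [TensorProduct.comm_symm_tmul, dualTensorHomEquiv, LinearEquiv.ofBijective_apply,
    dualTensorHom_apply]
  -- Both sides are now multiples of the volume form, so only one scalar is left to compare.
  refine (form_eq_smul_volumeForm _).trans ?_
  congr 1
  change Ψ (wedge W _ ξ (exteriorPower.map m D _)) = Ψ _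
  rw [exteriorPower.map_apply_ιMulti]
  congr 1
  exact Subtype.ext (mul_ιMulti_comm ξ.2 _)

theorem lTensor_jacobianMap [Module.Finite ℂ W] {m q n : ℕ} (h : m + q = n)
    (D : CSpace m →ₗ[ℂ] W) (x : U ⊗[ℂ] (⋀[ℂ]^q W)) :
    LinearMap.lTensor U (jacobianMap h D) x = LinearEquiv.lTensor U (jacobianEquiv W m q n)
      (LinearMap.lTensor U (wedge W h
        (exteriorPower.ιMulti ℂ m fun j => D (EuclideanSpace.single j (1 : ℂ)))) x) := by
  induction x using TensorProduct.induction_on with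
  | zero => simp
  | tmul e ξ => simp [jacobianMap_eq]
  | add x y hx hy => simp only [map_add, hx, hy]

theorem map_lTensor_jacobianEquiv [Module.Finite ℂ V] [Module.Finite ℂ W] {U' : Type*}
    [AddCommGroup U'] [Module ℂ U'] (m q n : ℕ) (A : U →ₗ[ℂ] U') (T : V →ₗ[ℂ] W)
    (x : U ⊗[ℂ] (⋀[ℂ]^n V)) :
    TensorProduct.map A (TensorProduct.map LinearMap.id (pullbackForm n T).dualMap)
        (LinearEquiv.lTensor U (jacobianEquiv V m q n) x)
      = LinearEquiv.lTensor U' (jacobianEquiv W m q n)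
        (TensorProduct.map A (exteriorPower.map n T) x) := by
  induction x using TensorProduct.induction_on with
  | zero => simp
  | tmul e ξ => simp [jacobianEquiv_naturality]
  | add x y hx hy => simp only [map_add, hx, hy]

end LinearAlgebra

open Filter Topology

/-! ### Zero divisors and the identity theorem for sections. -/

section Sections

variable {m : ℕ} {L : CSpace m → Type*} [∀ z, AddCommGroup (L z)] [∀ z, Module ℂ (L z)]
  {V : Type*} [AddCommGroup V] [Module ℂ V]
  {L' : CSpace m → Type*} [∀ z, AddCommGroup (L' z)] [∀ z, Module ℂ (L' z)]
  {V' : Type*} [AddCommGroup V'] [Module ℂ V']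

theorem IsHolomorphicSection.congr_linearEquiv {c : ∀ _z₀ z : CSpace m, L z →ₗ[ℂ] V}
    {c' : ∀ _z₀ z : CSpace m, L' z →ₗ[ℂ] V'} {s : ∀ z, L z} {s' : ∀ z, L' z} (J : V ≃ₗ[ℂ] V')
    (h : ∀ z₀ z, c' z₀ z (s' z) = J (c z₀ z (s z))) (hs : IsHolomorphicSection c s) :
    IsHolomorphicSection c' s' := fun z₀ ℓ => by
  simpa only [h] using! hs z₀ (ℓ ∘ₗ J.toLinearMap)

/-- The multiplicity is an infimum over all functionals, and the transpose of `J` merely permutes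
the index set. -/
theorem zeroDivisor_congr_linearEquiv {c : ∀ _z₀ z : CSpace m, L z →ₗ[ℂ] V}
    {c' : ∀ _z₀ z : CSpace m, L' z →ₗ[ℂ] V'} {s : ∀ z, L z} {s' : ∀ z, L' z} (J : V ≃ₗ[ℂ] V')
    (h : ∀ z₀ z, c' z₀ z (s' z) = J (c z₀ z (s z))) : zeroDivisor c' s' = zeroDivisor c s := by
  funext z₀
  simp only [zeroDivisor, h]
  exact J.dualMap.toEquiv.iInf_congr fun ℓ => rfl

/-- The identity theorem for sections of a holomorphic bundle over `ℂ^m`. -/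
theorem IsHolomorphicSection.isEffectiveSection [Module.Finite ℂ V]
    {c : ∀ _z₀ z : CSpace m, L z →ₗ[ℂ] V} {s : ∀ z, L z} (hs : IsHolomorphicSection c s)
    (hc : ∀ z₀, ∀ᶠ z in 𝓝 z₀, Function.Injective (c z₀ z)) (hne : ∃ z, s z ≠ 0) :
    IsEffectiveSection s := by
  obtain ⟨z, hz⟩ := hne
  rw [IsEffectiveSection, IsThin, ← interior_eq_empty_iff_dense_compl]
  -- An open and closed subset of `ℂ^m` is empty or everything, and the latter contradicts `s z ≠
  -- 0`.
  have hclosed : IsClosed (interior {z | s z = 0}) := by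
    refine isClosed_of_closure_subset fun z₀ hz₀ => ?_
    -- Holomorphy is assumed only at the centre of each trivialization; it spreads to a
    -- neighbourhood common to the finitely many coordinates.
    have han : ∀ᶠ z in 𝓝 z₀, ∀ i, AnalyticAt ℂ
        (fun w => (Module.finBasis ℂ V).coord i (c z₀ w (s w))) z :=
      eventually_all.2 fun i => (hs z₀ _).eventually_analyticAt
    obtain ⟨ε, hε, hball⟩ := Metric.eventually_nhds_iff_ball.1 ((hc z₀).and han)
    obtain ⟨z₁, hz₁, hz₁'⟩ := mem_closure_iff.1 hz₀ _ Metric.isOpen_ball (Metric.mem_ball_self hε)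
    refine mem_interior.2 ⟨_, fun w hw => ?_, Metric.isOpen_ball, Metric.mem_ball_self hε⟩
    refine (hball w hw).1 (((Module.finBasis ℂ V).ext_elem fun i => ?_).trans (map_zero _).symm)
    have := AnalyticOnNhd.eqOn_zero_of_preconnected_of_eventuallyEq_zero
      (fun y hy => (hball y hy).2 i) (convex_ball z₀ ε).isPreconnected hz₁
      (by filter_upwards [mem_interior_iff_mem_nhds.1 hz₁'] with y hy
          simp [show s y = 0 from hy]) hw
    simpa using! this
  rcases isClopen_iff.1 ⟨hclosed, isOpen_interior⟩ with h | h
  · exact h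
  · exact absurd ((Set.ext_iff.1 (interior_eq_univ.1 h) z).2 trivial) hz

end Sections

/-! ### Analyticity of multilinear expressions, tested on linear functionals. -/

section Analytic

variable {G : Type*} [NormedAddCommGroup G] [NormedSpace ℂ G] {A B : Type*} [AddCommGroup A]
  [Module ℂ A] [AddCommGroup B] [Module ℂ B] [Module.Finite ℂ A] [Module.Finite ℂ B]

/-- In bases this is a polynomial in the coordinates, so `A` and `B` need no norm; exterior powers
and tensor products can be inserted directly. -/
theorem analyticAt_bilin (β : A →ₗ[ℂ] B →ₗ[ℂ] ℂ) {a : G → A} {b : G → B} {z₀ : G}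
    (ha : ∀ ℓ : Module.Dual ℂ A, AnalyticAt ℂ (fun z => ℓ (a z)) z₀)
    (hb : ∀ ℓ : Module.Dual ℂ B, AnalyticAt ℂ (fun z => ℓ (b z)) z₀) :
    AnalyticAt ℂ (fun z => β (a z) (b z)) z₀ := by
  have h : (fun z => β (a z) (b z)) = fun z => ∑ i, ∑ j, (Module.finBasis ℂ A).coord i (a z) *
      ((Module.finBasis ℂ B).coord j (b z)) * β (Module.finBasis ℂ A i) (Module.finBasis ℂ B j) := by
    funext z
    conv_lhs => rw [← (Module.finBasis ℂ A).sum_repr (a z), ← (Module.finBasis ℂ B).sum_repr (b z)]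
    simp only [map_sum, LinearMap.sum_apply, map_smul, LinearMap.smul_apply, smul_eq_mul,
      Module.Basis.coord_apply, Finset.mul_sum, mul_assoc]
    rw [Finset.sum_comm]
    exact Finset.sum_congr rfl fun i _ => Finset.sum_congr rfl fun j _ => mul_left_comm _ _ _
  rw [h]
  exact Finset.analyticAt_fun_sum _ fun i _ => Finset.analyticAt_fun_sum _ fun j _ =>
    ((ha _).mul (hb _)).mul analyticAt_const

theorem analyticAt_multilinearMap {ι : Type*} [Fintype ι] [DecidableEq ι]
    (μ : MultilinearMap ℂ (fun _ : ι => A) ℂ) {v : G → ι → A} {z₀ : G}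
    (hv : ∀ i, ∀ ℓ : Module.Dual ℂ A, AnalyticAt ℂ (fun z => ℓ (v z i)) z₀) :
    AnalyticAt ℂ (fun z => μ (v z)) z₀ := by
  have h : (fun z => μ (v z)) = fun z => ∑ r : ι → Fin (Module.finrank ℂ A),
      (∏ i, (Module.finBasis ℂ A).coord (r i) (v z i)) * μ fun i => Module.finBasis ℂ A (r i) := by
    funext z
    have hz : v z = fun i => ∑ j, (Module.finBasis ℂ A).coord j (v z i) • Module.finBasis ℂ A j :=
      funext fun i => ((Module.finBasis ℂ A).sum_repr (v z i)).symm
    conv_lhs => rw [hz, MultilinearMap.map_sum]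
    exact Finset.sum_congr rfl fun r _ => MultilinearMap.map_smul_univ _ _ _
  rw [h]
  exact Finset.analyticAt_fun_sum _ fun r _ =>
    (Finset.analyticAt_fun_prod _ fun i _ => hv i _).mul analyticAt_const

theorem analyticAt_ιMulti {k : ℕ} {v : G → Fin k → A} {z₀ : G}
    (hv : ∀ i, ∀ ℓ : Module.Dual ℂ A, AnalyticAt ℂ (fun z => ℓ (v z i)) z₀)
    (ℓ : Module.Dual ℂ (⋀[ℂ]^k A)) :
    AnalyticAt ℂ (fun z => ℓ (exteriorPower.ιMulti ℂ k (v z))) z₀ :=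
  analyticAt_multilinearMap
    (ℓ.compAlternatingMap (exteriorPower.ιMulti ℂ k)).toMultilinearMap hv

end Analytic

/-! ### The Jacobian and wedge sections in local trivializations. -/

section Fields

variable {m q n : ℕ} {X : Type*} [TopologicalSpace X] [ChartedSpace (CSpace n) X]

theorem jacobianSection_eq {E : X → Type*} [∀ x, AddCommGroup (E x)] [∀ x, Module ℂ (E x)]
    (h : m + q = n) (f : CSpace m → X) (φ : ∀ z, FieldFibre (n := n) E q (f z)) (z : CSpace m) :
    jacobianSection h f φ z = LinearEquiv.lTensor (E (f z))
      (jacobianEquiv (TangentSpace 𝓘(ℂ, CSpace n) (f z)) m q n) (wedgeSection h f φ z) :=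
  lTensor_jacobianMap h (differential f z) (φ z)

variable [IsManifold 𝓘(ℂ, CSpace n) ω X]
  (E : X → Type*) [∀ x, AddCommGroup (E x)] [∀ x, Module ℂ (E x)]
  [∀ x, TopologicalSpace (E x)] [TopologicalSpace (Bundle.TotalSpace ℂ E)]
  [FiberBundle ℂ E] [VectorBundle ℂ ℂ E]

theorem jacobianCoord_jacobianSection (h : m + q = n) (f : CSpace m → X)
    (φ : ∀ z, FieldFibre (n := n) E q (f z)) (z₀ z : CSpace m) :
    jacobianCoord E f z₀ z (jacobianSection h f φ z)
      = LinearEquiv.lTensor ℂ (jacobianEquiv (CSpace n) m q n)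
        (fieldCoord E f n z₀ z (wedgeSection h f φ z)) := by
  rw [jacobianSection_eq]
  exact map_lTensor_jacobianEquiv m q n (lineCoord E (f z₀) (f z))
    (tangentCoord (n := n) (f z₀) (f z)) (wedgeSection h f φ z)

theorem fieldCoord_wedgeSection (h : m + q = n) (f : CSpace m → X)
    (φ : ∀ z, FieldFibre (n := n) E q (f z)) (z₀ z : CSpace m) :
    fieldCoord E f n z₀ z (wedgeSection h f φ z)
      = LinearMap.lTensor ℂ (wedge (CSpace n) h (exteriorPower.ιMulti ℂ m fun j =>
          tangentCoord (n := n) (f z₀) (f z) (pushforwardCoordField (n := n) f j z)))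
        (fieldCoord E f q z₀ z (φ z)) := by
  rw [wedgeSection]
  induction φ z using TensorProduct.induction_on with
  | zero => simp
  | tmul e ξ =>
    rw [LinearMap.lTensor_tmul, fieldCoord, fieldCoord, TensorProduct.map_tmul,
      TensorProduct.map_tmul, LinearMap.lTensor_tmul, map_wedge, exteriorPower.map_apply_ιMulti]
    rfl
  | add x y hx hy => rw [map_add, map_add, hx, hy, map_add, map_add]

theorem tangentCoord_injective {x₀ x : X}
    (hx : x ∈ (trivializationAt (CSpace n) (fun y : X => TangentSpace 𝓘(ℂ, CSpace n) y) x₀).baseSet) :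
    Function.Injective (tangentCoord (n := n) x₀ x) :=
  Function.LeftInverse.injective (Bundle.Trivialization.symm_linearMapAt (R := ℂ)
    (trivializationAt (CSpace n) (fun y : X => TangentSpace 𝓘(ℂ, CSpace n) y) x₀) hx)

theorem lineCoord_injective {x₀ x : X} (hx : x ∈ (trivializationAt ℂ E x₀).baseSet) :
    Function.Injective (lineCoord E x₀ x) :=
  Function.LeftInverse.injective (Bundle.Trivialization.symm_linearMapAt (R := ℂ)
    (trivializationAt ℂ E x₀) hx)

/-- Over a field, exterior powers and tensor products of injective maps are injective. -/
theorem eventually_fieldCoord_injective {f : CSpace m → X} (hf : Continuous f) (k : ℕ)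
    (z₀ : CSpace m) : ∀ᶠ z in 𝓝 z₀, Function.Injective (fieldCoord (n := n) E f k z₀ z) := by
  have hT := hf.continuousAt.eventually_mem
    ((trivializationAt (CSpace n) (fun y : X => TangentSpace 𝓘(ℂ, CSpace n) y)
      (f z₀)).open_baseSet.mem_nhds
      (FiberBundle.mem_baseSet_trivializationAt' (f z₀)))
  have hE := hf.continuousAt.eventually_mem ((trivializationAt ℂ E (f z₀)).open_baseSet.mem_nhds
      (FiberBundle.mem_baseSet_trivializationAt' (f z₀)))
  filter_upwards [hT, hE] with z hzT hzE
  exact TensorProduct.map_injective_of_flat_flat _ _ (lineCoord_injective E hzE)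
    (exteriorPower.map_injective_field (tangentCoord_injective (n := n) hzT))

theorem analyticAt_tangentCoord_pushforward {f : CSpace m → X}
    (hf : ContMDiff 𝓘(ℂ, CSpace m) 𝓘(ℂ, CSpace n) ω f) (j : Fin m) (z₀ : CSpace m) :
    AnalyticAt ℂ (fun z => tangentCoord (n := n) (f z₀) (f z)
      (pushforwardCoordField (n := n) f j z)) z₀ := by
  have h := (hf.contMDiffAt (x := z₀)).mfderiv_const (m := ω) (by simp)
  have h' := ((ContinuousLinearMap.apply ℂ (CSpace n)
    (EuclideanSpace.single j (1 : ℂ) : CSpace m)).analyticAt _).comp h.contDiffAt.analyticAt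
  refine h'.congr (Eventually.of_forall fun z => ?_)
  -- The derivative in tangent coordinates also involves the trivialization of the source, which is
  -- the identity on `ℂ^m`.
  change (tangentCoord (n := n) (f z₀) (f z)) (mfderiv 𝓘(ℂ, CSpace m) 𝓘(ℂ, CSpace n) f z
    ((trivializationAt (CSpace m) (TangentSpace 𝓘(ℂ, CSpace m)) z₀).symmL ℂ z _)) = _
  rw [TangentBundle.symmL_model_space]
  rfl

theorem isHolomorphicSection_wedgeSection (h : m + q = n) {f : CSpace m → X}
    (hf : ContMDiff 𝓘(ℂ, CSpace m) 𝓘(ℂ, CSpace n) ω f)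
    {φ : ∀ z, FieldFibre (n := n) E q (f z)} (hφ : IsHolomorphicField E f q φ) :
    IsHolomorphicSection (fieldCoord E f n) (wedgeSection h f φ) := fun z₀ ℓ => by
  simp only [fieldCoord_wedgeSection]
  exact analyticAt_bilin ((LinearMap.lTensorHom ℂ ∘ₗ wedge (CSpace n) h).compr₂ ℓ)
    (analyticAt_ιMulti fun j ℓ' => (ℓ'.toContinuousLinearMap.analyticAt _).comp
      (analyticAt_tangentCoord_pushforward hf j z₀)) (hφ z₀)

end Fields

end

end JacobianSection

theorem theorem2p5 {m q n : ℕ} (hq : 0 < q) (hmq : m + q = n)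
    {X : Type*} [TopologicalSpace X] [ChartedSpace (JacobianSection.CSpace n) X]
    [IsManifold 𝓘(ℂ, JacobianSection.CSpace n) ω X]
    (E : X → Type*) [∀ x, AddCommGroup (E x)] [∀ x, Module ℂ (E x)]
    [∀ x, TopologicalSpace (E x)] [TopologicalSpace (Bundle.TotalSpace ℂ E)]
    [FiberBundle ℂ E] [VectorBundle ℂ ℂ E]
    [ContMDiffVectorBundle ω ℂ E 𝓘(ℂ, JacobianSection.CSpace n)]
    (f : JacobianSection.CSpace m → X)
    (hf : ContMDiff 𝓘(ℂ, JacobianSection.CSpace m) 𝓘(ℂ, JacobianSection.CSpace n) ω f)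
    (φ : ∀ z, JacobianSection.FieldFibre (n := n) E q (f z))
    (hφ : JacobianSection.IsHolomorphicField E f q φ) :
    JacobianSection.IsHolomorphicSection (JacobianSection.jacobianCoord E f)
        (JacobianSection.jacobianSection hmq f φ) ∧
      JacobianSection.IsHolomorphicSection (JacobianSection.fieldCoord E f n)
        (JacobianSection.wedgeSection hmq f φ) ∧
      (JacobianSection.IsEffectiveField hmq f φ ↔
        ∃ z, JacobianSection.wedgeSection hmq f φ z ≠ 0) ∧
      JacobianSection.zeroDivisor (JacobianSection.jacobianCoord E f)
          (JacobianSection.jacobianSection hmq f φ) =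
        JacobianSection.zeroDivisor (JacobianSection.fieldCoord E f n)
          (JacobianSection.wedgeSection hmq f φ) := by
  have hZ := JacobianSection.isHolomorphicSection_wedgeSection E hmq hf hφ
  have hJ := JacobianSection.jacobianCoord_jacobianSection E hmq f φ
  refine ⟨hZ.congr_linearEquiv _ hJ, hZ, ⟨fun h => ?_, fun h => ?_⟩,
    JacobianSection.zeroDivisor_congr_linearEquiv _ hJ⟩
  · obtain ⟨z, hz⟩ := Dense.nonempty h
    refine ⟨z, fun h0 => hz ?_⟩
    exact (JacobianSection.jacobianSection_eq hmq f φ z).trans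
      ((LinearEquiv.map_eq_zero_iff _).2 h0)
  -- Thinness is proved for the wedge section and transferred through the equality of zero sets.
  · have hd := hZ.isEffectiveSection
      (JacobianSection.eventually_fieldCoord_injective E hf.continuous n) h
    refine Dense.mono (Set.compl_subset_compl.2 fun z h0 => ?_) hd
    exact (LinearEquiv.map_eq_zero_iff _).1
      ((JacobianSection.jacobianSection_eq hmq f φ z).symm.trans h0)
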